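/- Let $\mathcal S\subset\mathbb R^3$ be a $3$-simplex with vertices $v_0,v_1,v_2,v_3$, facets $\mathcal F_j=\operatorname{co}\{v_i : i\neq j\}$, and let $h_j$ be an outward pointing normal vector to $\mathcal F_j$ for each $j$. Consider an affine control system $\dot x=Ax+Bu+a$ with state $x\in\mathbb R^3$ and input $u\in\mathbb R^m$, and put $$\mathcal B=\operatorname{Im}B,\qquad \mathcal O=\{x\in\mathbb R^3 : Ax+a\in\mathcal B\},\qquad \mathcal O_{\mathcal S}=\mathcal S\cap\mathcal O.$$ For $x\in\mathcal S$ let $I(x)\subseteq\{0,1,2,3\}$ be the smallest set of indices with $x\in\operatorname{co}\{v_i : i\in I(x)\}$, and let $$\mathcal C(x)=\{y\in\mathbb R^3 : h_j\cdot y\le 0\ \text{for all } j\in\{1,2,3\}\setminus I(x)\},\qquad \operatorname{cone}(\mathcal O_{\mathcal S})=\bigcap_{x\in\mathcal O_{\mathcal S}}\mathcal C(x).$$ Suppose that $\mathcal O_{\mathcal S}=\operatorname{co}\{o_1,o_2,o_3\}$ with $v_0\notin\mathcal O_{\mathcal S}$ and $o_i\in(v_0,v_i]=\{(1-t)v_0+tv_i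 : 0<t\le 1\}$ for $i=1,2,3$. Then: 1. there exists a continuous map $f:\mathcal O_{\mathcal S}\to\mathcal B\setminus\{0\}$ with $f(x)\in\mathcal C(x)$ for all $x\in\mathcal O_{\mathcal S}$ if and only if $\mathcal B\cap\operatorname{cone}(\mathcal O_{\mathcal S})\neq\{0\}$; 2. there exists an affine map $f:\mathcal O_{\mathcal S}\to\mathcal B$ with $f(x)\in\mathcal C(x)$ and $f(x)\neq 0$ for all $x\in\mathcal O_{\mathcal S}$ if and only if $\mathcal B\cap\operatorname{cone}(\mathcal O_{\mathcal S})\neq\{0\}$. -/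

import Mathlib

namespace ReachControl

/-- The affine control system `ẋ = A x + B u + a` with states in `ℝⁿ` and inputs in `ℝᵐ`. -/
structure ControlSystem (n m : ℕ) where
  /-- the drift matrix, as a linear map -/
  A : EuclideanSpace ℝ (Fin n) →ₗ[ℝ] EuclideanSpace ℝ (Fin n)
  /-- the input matrix, as a linear map -/
  B : EuclideanSpace ℝ (Fin m) →ₗ[ℝ] EuclideanSpace ℝ (Fin n)
  /-- the constant drift vector -/
  a : EuclideanSpace ℝ (Fin n)

variable {n m : ℕ}

/-- The subspace `𝓑 = Im B`. -/
def ControlSystem.inputSpace (sys : ControlSystem n m) :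
    Submodule ℝ (EuclideanSpace ℝ (Fin n)) :=
  LinearMap.range sys.B

/-- The set `𝒪 = {x | A x + a ∈ 𝓑}` of possible equilibria. -/
def ControlSystem.equilibria (sys : ControlSystem n m) : Set (EuclideanSpace ℝ (Fin n)) :=
  {x | sys.A x + sys.a ∈ sys.inputSpace}

/-- The simplex `𝒮`, as the convex hull of its vertices `v₀, …, vₙ`. -/
def body (S : Affine.Simplex ℝ (EuclideanSpace ℝ (Fin n)) n) :
    Set (EuclideanSpace ℝ (Fin n)) :=
  convexHull ℝ (Set.range S.points)

/-- The facet `𝓕_j`, spanned by all the vertices other than `v_j`. -/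
def facet (S : Affine.Simplex ℝ (EuclideanSpace ℝ (Fin n)) n) (j : Fin (n + 1)) :
    Set (EuclideanSpace ℝ (Fin n)) :=
  convexHull ℝ (S.points '' {j}ᶜ)

/-- The vector `h` is an outward pointing normal to the facet `𝓕_j`: it is non-zero, orthogonal
to the facet, and the simplex lies on the non-positive side of the facet. -/
def IsOutwardNormal (S : Affine.Simplex ℝ (EuclideanSpace ℝ (Fin n)) n) (j : Fin (n + 1))
    (h : EuclideanSpace ℝ (Fin n)) : Prop :=
  h ≠ 0 ∧ (∀ x ∈ facet S j, ∀ y ∈ facet S j, inner ℝ h (y - x) = 0) ∧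
    ∀ x ∈ facet S j, ∀ z ∈ body S, inner ℝ h (z - x) ≤ 0

/-- The index set `I(x)`: the smallest set `J` of indices such that `x` lies in the convex hull of
the vertices `v_i`, `i ∈ J`, written as the intersection of all such `J`
(see `isLeast_supportIndices`). -/
def supportIndices (S : Affine.Simplex ℝ (EuclideanSpace ℝ (Fin n)) n)
    (x : EuclideanSpace ℝ (Fin n)) : Set (Fin (n + 1)) :=
  ⋂₀ {J | x ∈ convexHull ℝ (S.points '' J)}

/-- For `x` in the simplex, `I(x)` is the minimum of the index sets `J` with
`x ∈ co {v_i | i ∈ J}`. -/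
theorem isLeast_supportIndices (S : Affine.Simplex ℝ (EuclideanSpace ℝ (Fin n)) n)
    (x : EuclideanSpace ℝ (Fin n)) (hx : x ∈ body S) :
    IsLeast {J | x ∈ convexHull ℝ (S.points '' J)} (supportIndices S x) := by
  classical
  refine ⟨?_, fun J hJ => Set.sInter_subset_of_mem hJ⟩
  have hinter : ∀ J K : Set (Fin (n + 1)), x ∈ convexHull ℝ (S.points '' J) →
      x ∈ convexHull ℝ (S.points '' K) → x ∈ convexHull ℝ (S.points '' (J ∩ K)) := by
    intro J K hJ hK
    have hS : AffineIndependent ℝ ((↑) : ↥(Finset.univ.image S.points) →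
        EuclideanSpace ℝ (Fin n)) := by
      have e : ((Finset.univ.image S.points : Finset _) : Set (EuclideanSpace ℝ (Fin n))) =
          Set.range S.points := by simp
      exact S.independent.range.mono e.le
    have key := hS.convexHull_inter (t₁ := J.toFinset.image S.points)
      (t₂ := K.toFinset.image S.points)
      (Finset.image_subset_image (Finset.subset_univ _))
      (Finset.image_subset_image (Finset.subset_univ _))
    simp only [Finset.coe_image, Set.coe_toFinset] at key
    rw [Set.image_inter S.independent.injective, key]
    exact ⟨hJ, hK⟩
  have hfin : ∀ F : Finset (Set (Fin (n + 1))),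
      (∀ J ∈ F, x ∈ convexHull ℝ (S.points '' J)) →
        x ∈ convexHull ℝ (S.points '' ⋂₀ (F : Set (Set (Fin (n + 1))))) := by
    intro F
    induction F using Finset.induction_on with
    | empty => intro _; simpa [body] using hx
    | insert J F _ ih =>
      intro hF
      rw [Finset.coe_insert, Set.sInter_insert]
      exact hinter _ _ (hF J (Finset.mem_insert_self _ _))
        (ih fun K hK => hF K (Finset.mem_insert_of_mem hK))
  have := hfin (Set.toFinite {J | x ∈ convexHull ℝ (S.points '' J)}).toFinset (by simp)
  simpa [supportIndices] using this

/-- The inside pointing cone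
`𝓒(x) = {y | h_j · y ≤ 0 for all j ∈ {1, …, n} \ I(x)}`. -/
def insideCone (S : Affine.Simplex ℝ (EuclideanSpace ℝ (Fin n)) n)
    (h : Fin (n + 1) → EuclideanSpace ℝ (Fin n)) (x : EuclideanSpace ℝ (Fin n)) :
    Set (EuclideanSpace ℝ (Fin n)) :=
  {y | ∀ j : Fin (n + 1), j ≠ 0 → j ∉ supportIndices S x → inner ℝ (h j) y ≤ 0}

/-- The set `𝒪_𝒮 = 𝒮 ∩ 𝒪`. -/
def equilibriaIn (S : Affine.Simplex ℝ (EuclideanSpace ℝ (Fin n)) n) (sys : ControlSystem n m) :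
    Set (EuclideanSpace ℝ (Fin n)) :=
  body S ∩ sys.equilibria

/-- The cone `cone(P) = ⋂_{x ∈ P} 𝓒(x)`. -/
def coneOf (S : Affine.Simplex ℝ (EuclideanSpace ℝ (Fin n)) n)
    (h : Fin (n + 1) → EuclideanSpace ℝ (Fin n)) (P : Set (EuclideanSpace ℝ (Fin n))) :
    Set (EuclideanSpace ℝ (Fin n)) :=
  ⋂ x ∈ P, insideCone S h x

/-- The affine obstruction problem: there is an affine map `f : 𝒪_𝒮 → 𝓑` (the restriction to
`𝒪_𝒮` of an affine map of `ℝⁿ`) with `f x ∈ 𝓒(x)` and `f x ≠ 0` for all `x ∈ 𝒪_𝒮`. -/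
def AffineSolvable (S : Affine.Simplex ℝ (EuclideanSpace ℝ (Fin n)) n)
    (h : Fin (n + 1) → EuclideanSpace ℝ (Fin n)) (sys : ControlSystem n m) : Prop :=
  ∃ f : equilibriaIn S sys → sys.inputSpace,
    (∃ g : EuclideanSpace ℝ (Fin n) →ᵃ[ℝ] EuclideanSpace ℝ (Fin n),
      ∀ x, (f x : EuclideanSpace ℝ (Fin n)) = g x) ∧
    (∀ x : equilibriaIn S sys, (f x : EuclideanSpace ℝ (Fin n)) ∈ insideCone S h x) ∧ ∀ x, f x ≠ 0

/-- The topological obstruction problem: there is a continuous map `f : 𝒪_𝒮 → 𝓑 \ {0}` with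
`f x ∈ 𝓒(x)` for all `x ∈ 𝒪_𝒮`. -/
def ContinuousSolvable (S : Affine.Simplex ℝ (EuclideanSpace ℝ (Fin n)) n)
    (h : Fin (n + 1) → EuclideanSpace ℝ (Fin n)) (sys : ControlSystem n m) : Prop :=
  ∃ f : equilibriaIn S sys → sys.inputSpace,
    Continuous f ∧
    (∀ x : equilibriaIn S sys, (f x : EuclideanSpace ℝ (Fin n)) ∈ insideCone S h x) ∧ ∀ x, f x ≠ 0

end ReachControl

/-! A non-zero vector of `𝓑 ∩ cone(𝒪_𝒮)` is a constant solution of both problems, and affine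
solutions are continuous; the content is that a continuous solution forces such a vector. Suppose
the intersection is trivial. Then the image of `𝓑` under `y ↦ (-h_j · y)_j` meets the non-negative
orthant only in the origin, and Stiemke's lemma gives weights `c_j > 0` with `∑ c_j (h_j · y) = 0`
on `𝓑`. Pull a solution `f` back to the standard triangle and put `w_j = -c_j (h_j · f)`. The
coordinates of `w` sum to zero, and the cone condition makes `w_j ≥ 0` on the edge `x_j = 0`. By a
winding argument (`exists_eq_zero_of_nonneg_on_edges`) `w` vanishes somewhere; there `f` lies in `𝓑
∩ cone(𝒪_𝒮)`, so `f` vanishes too, a contradiction. -/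

/-! ### Winding of planar maps on a triangle -/

open Real in
/-- A real function on `[0, 1]` along which the cosine is non-negative stays within `π / 2` of a
single multiple of `2π`. -/
theorem exists_int_abs_sub_le_of_cos_nonneg {θ : ℝ → ℝ} (hθ : Continuous θ)
    (hcos : ∀ t ∈ Set.Icc (0 : ℝ) 1, 0 ≤ cos (θ t)) :
    ∃ k : ℤ, ∀ t ∈ Set.Icc (0 : ℝ) 1, |θ t - k * (2 * π)| ≤ π / 2 := by
  have hπ := pi_pos
  refine ⟨round (θ 0 / (2 * π)), fun t ht => ?_⟩
  set k : ℤ := round (θ 0 / (2 * π))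
  have hc : ∀ s ∈ Set.Icc (0 : ℝ) 1, 0 ≤ cos (θ s - k * (2 * π)) := fun s hs => by
    rw [cos_sub_int_mul_two_pi]
    exact hcos s hs
  have h0 : |θ 0 - k * (2 * π)| ≤ π := by
    have h := abs_sub_round (θ 0 / (2 * π))
    have e : θ 0 - k * (2 * π) = (θ 0 / (2 * π) - k) * (2 * π) := by field_simp
    rw [e, abs_mul, abs_of_pos (by positivity : 0 < 2 * π)]
    nlinarith
  rw [abs_le] at h0
  -- Otherwise the intermediate value theorem gives a point at distance exactly `π`, where the
  -- cosine is `-1`.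
  have hlt : |θ t - k * (2 * π)| < π := by
    by_contra! hge
    have hpre : IsPreconnected (Set.Icc (0 : ℝ) 1) := isPreconnected_Icc
    have hcont : ContinuousOn (fun s => θ s - k * (2 * π)) (Set.Icc 0 1) := by fun_prop
    have h01 : (0 : ℝ) ∈ Set.Icc (0 : ℝ) 1 := by simp
    rcases le_abs.mp hge with h | h
    · obtain ⟨s, hs, hsv⟩ := hpre.intermediate_value h01 ht hcont ⟨h0.2, h⟩
      have := hc s hs
      simp only at hsv
      rw [hsv, cos_pi] at this
      linarith
    · obtain ⟨s, hs, hsv⟩ := hpre.intermediate_value ht h01 hcont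
        ⟨(by linarith : θ t - k * (2 * π) ≤ -π), h0.1⟩
      have := hc s hs
      simp only at hsv
      rw [hsv, cos_neg, cos_pi] at this
      linarith
  by_contra! hgt
  have := cos_neg_of_pi_div_two_lt_of_lt hgt (by linarith)
  rw [cos_abs] at this
  linarith [hc t ht]

/-- A nowhere vanishing continuous complex function on a simply connected, locally path connected
space has a continuous logarithm. -/
theorem exists_continuous_exp_eq {X : Type*} [TopologicalSpace X] [SimplyConnectedSpace X]
    [LocallyPathConnectedSpace X] {F : X → ℂ} (hF : Continuous F) (h0 : ∀ x, F x ≠ 0) :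
    ∃ g : X → ℂ, Continuous g ∧ ∀ x, Complex.exp (g x) = F x := by
  obtain ⟨x₀⟩ := (inferInstance : Nonempty X)
  obtain ⟨g, ⟨-, hg⟩, -⟩ := Complex.isCoveringMapOn_exp.existsUnique_continuousMap_lifts
    ⟨F, hF⟩ (Complex.exp_log (h0 x₀)) h0
  exact ⟨g, g.continuous, fun x => congrFun hg x⟩

/-- A retraction of the plane onto the standard triangle, in barycentric coordinates. -/
noncomputable def triangleRetraction (p : ℝ × ℝ) : Fin 3 → ℝ :=
  ![1 - (max p.1 0 + max p.2 0) / max 1 (max p.1 0 + max p.2 0),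
    max p.1 0 / max 1 (max p.1 0 + max p.2 0),
    max p.2 0 / max 1 (max p.1 0 + max p.2 0)]

theorem continuous_triangleRetraction : Continuous triangleRetraction := by
  have h : ∀ p : ℝ × ℝ, max 1 (max p.1 0 + max p.2 0) ≠ 0 := fun p => by positivity
  refine continuous_pi fun i => ?_
  fin_cases i
  · exact continuous_const.sub (Continuous.div (by fun_prop) (by fun_prop) h)
  · exact Continuous.div (by fun_prop) (by fun_prop) h
  · exact Continuous.div (by fun_prop) (by fun_prop) h

theorem triangleRetraction_mem (p : ℝ × ℝ) : triangleRetraction p ∈ stdSimplex ℝ (Fin 3) := by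
  have hpos : 0 < max 1 (max p.1 0 + max p.2 0) := by positivity
  refine ⟨fun i => ?_, ?_⟩
  · fin_cases i
    · exact sub_nonneg.mpr ((div_le_one hpos).mpr (le_max_right _ _))
    · exact div_nonneg (le_max_right _ _) hpos.le
    · exact div_nonneg (le_max_right _ _) hpos.le
  · simp only [Fin.sum_univ_three, triangleRetraction, Matrix.cons_val_zero, Matrix.cons_val_one,
      Matrix.cons_val]
    ring

theorem triangleRetraction_of_nonneg {a b : ℝ} (ha : 0 ≤ a) (hb : 0 ≤ b) (hab : a + b ≤ 1) :
    triangleRetraction (a, b) = ![1 - (a + b), a, b] := by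
  simp [triangleRetraction, max_eq_left ha, max_eq_left hb, max_eq_left hab]

open Real in
/-- A continuous map `w` from the standard triangle to the plane `∑ i, w i = 0` whose `i`-th
coordinate is non-negative on the `i`-th edge has a zero. -/
theorem exists_eq_zero_of_nonneg_on_edges {w : (Fin 3 → ℝ) → Fin 3 → ℝ}
    (hw : ContinuousOn w (stdSimplex ℝ (Fin 3)))
    (hsum : ∀ x ∈ stdSimplex ℝ (Fin 3), ∑ i, w x i = 0)
    (hedge : ∀ x ∈ stdSimplex ℝ (Fin 3), ∀ i, x i = 0 → 0 ≤ w x i) :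
    ∃ x ∈ stdSimplex ℝ (Fin 3), w x = 0 := by
  by_contra! hne
  have hπ := pi_pos
  -- Extending to the whole plane gives a simply connected, locally path connected domain for the
  -- logarithm.
  set W : ℝ × ℝ → Fin 3 → ℝ := fun p => w (triangleRetraction p)
  have hW : Continuous W :=
    hw.comp_continuous continuous_triangleRetraction triangleRetraction_mem
  have hWi : ∀ i, Continuous fun p => W p i := fun i => (continuous_apply i).comp hW
  have hWsum : ∀ p, W p 0 + W p 1 + W p 2 = 0 := fun p => by
    rw [← Fin.sum_univ_three]
    exact hsum _ (triangleRetraction_mem p)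
  have h3 : (√3 : ℝ) * √3 = 3 := mul_self_sqrt (by norm_num)
  -- With `ω = exp (2πi/3)`, this complex number is `W 0 + ω W 1 + ω² W 2`. Its component in the
  -- direction `ω ^ i` is `3/2 * W p i`, so on edge `i` its argument is within `π / 2` of `2πi/3`
  -- modulo `2π`.
  obtain ⟨g, hg, hexp⟩ := exists_continuous_exp_eq
    (F := fun p => (⟨3 / 2 * W p 0, √3 / 2 * (W p 1 - W p 2)⟩ : ℂ))
    (by
      have : (fun p => (⟨3 / 2 * W p 0, √3 / 2 * (W p 1 - W p 2)⟩ : ℂ)) = fun p =>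
          ((3 / 2 * W p 0 : ℝ) : ℂ) + ((√3 / 2 * (W p 1 - W p 2) : ℝ) : ℂ) * Complex.I := by
        funext p
        exact Complex.mk_eq_add_mul_I _ _
      rw [this]
      have h0 := hWi 0
      have h1 := hWi 1
      have h2 := hWi 2
      fun_prop)
    (fun p hp => by
      refine hne _ (triangleRetraction_mem p) ?_
      obtain ⟨hre, him⟩ := Complex.ext_iff.mp hp
      simp only [Complex.zero_re, Complex.zero_im, mul_eq_zero, div_eq_zero_iff] at hre him
      have h0 : W p 0 = 0 := by simpa using hre
      have h12 : W p 1 - W p 2 = 0 := by simpa using him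
      have hs := hWsum p
      funext i
      change W p i = 0
      fin_cases i <;> simp <;> linarith)
  set θ : ℝ × ℝ → ℝ := fun p => (g p).im
  have hθ : Continuous θ := Complex.continuous_im.comp hg
  have hre : ∀ p, rexp (g p).re * cos (θ p) = 3 / 2 * W p 0 := fun p => by
    rw [← Complex.exp_re, hexp]
  have him : ∀ p, rexp (g p).re * sin (θ p) = √3 / 2 * (W p 1 - W p 2) := fun p => by
    rw [← Complex.exp_im, hexp]
  have hc : cos (π / 3 * 2) = -1 / 2 := by
    rw [show π / 3 * 2 = π - π / 3 by ring, cos_pi_sub, cos_pi_div_three]; ring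
  have hs : sin (π / 3 * 2) = √3 / 2 := by
    rw [show π / 3 * 2 = π - π / 3 by ring, sin_pi_sub, sin_pi_div_three]
  have hc' : cos (π / 3 * 4) = -1 / 2 := by
    rw [show π / 3 * 4 = π / 3 + π by ring, cos_add_pi, cos_pi_div_three]; ring
  have hs' : sin (π / 3 * 4) = -(√3 / 2) := by
    rw [show π / 3 * 4 = π / 3 + π by ring, sin_add_pi, sin_pi_div_three]
  have hcos0 : ∀ p, 0 ≤ W p 0 → 0 ≤ cos (θ p) := fun p hp =>
    nonneg_of_mul_nonneg_right (by rw [hre]; positivity) (exp_pos (g p).re)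
  have hcos1 : ∀ p, 0 ≤ W p 1 → 0 ≤ cos (θ p - π / 3 * 2) := fun p hp => by
    refine nonneg_of_mul_nonneg_right ?_ (exp_pos (g p).re)
    have : rexp (g p).re * cos (θ p - π / 3 * 2) = 3 / 2 * W p 1 := by
      rw [cos_sub, hc, hs]
      linear_combination (-1 / 2) * hre p + √3 / 2 * him p + (W p 1 - W p 2) / 4 * h3 -
        3 / 4 * hWsum p
    rw [this]
    positivity
  have hcos2 : ∀ p, 0 ≤ W p 2 → 0 ≤ cos (θ p - π / 3 * 4) := fun p hp => by
    refine nonneg_of_mul_nonneg_right ?_ (exp_pos (g p).re)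
    have : rexp (g p).re * cos (θ p - π / 3 * 4) = 3 / 2 * W p 2 := by
      rw [cos_sub, hc', hs']
      linear_combination (-1 / 2) * hre p - √3 / 2 * him p - (W p 1 - W p 2) / 4 * h3 -
        3 / 4 * hWsum p
    rw [this]
    positivity
  have hWedge : ∀ p i, triangleRetraction p i = 0 → 0 ≤ W p i := fun p i hp =>
    hedge _ (triangleRetraction_mem p) i hp
  obtain ⟨k₀, hk₀⟩ := exists_int_abs_sub_le_of_cos_nonneg (θ := fun t => θ (1 - t, t))
    (by fun_prop) fun t ht => hcos0 _ <| hWedge _ _ <| by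
      rw [triangleRetraction_of_nonneg (by linarith [ht.2]) ht.1 (by linarith)]; simp
  obtain ⟨k₁, hk₁⟩ := exists_int_abs_sub_le_of_cos_nonneg (θ := fun t => θ (0, t) - π / 3 * 2)
    (by fun_prop) fun t ht => hcos1 _ <| hWedge _ _ <| by
      rw [triangleRetraction_of_nonneg le_rfl ht.1 (by linarith [ht.2])]; simp
  obtain ⟨k₂, hk₂⟩ := exists_int_abs_sub_le_of_cos_nonneg (θ := fun t => θ (t, 0) - π / 3 * 4)
    (by fun_prop) fun t ht => hcos2 _ <| hWedge _ _ <| by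
      rw [triangleRetraction_of_nonneg ht.1 le_rfl (by linarith [ht.2])]; simp
  have z : (0 : ℝ) ∈ Set.Icc (0 : ℝ) 1 := by simp
  have o : (1 : ℝ) ∈ Set.Icc (0 : ℝ) 1 := by simp
  -- Two edges share each vertex, so comparing their bounds there gives `k₁ = k₂`, `k₀ ≤ k₁` and `k₂
  -- < k₀`: the argument would have to make a full turn around the boundary.
  have a00 := abs_le.mp (hk₀ 0 z)
  have a01 := abs_le.mp (hk₀ 1 o)
  have a10 := abs_le.mp (hk₁ 0 z)
  have a11 := abs_le.mp (hk₁ 1 o)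
  have a20 := abs_le.mp (hk₂ 0 z)
  have a21 := abs_le.mp (hk₂ 1 o)
  simp only [sub_zero, sub_self] at a00 a01 a10 a11 a20 a21
  have hlt : ∀ a b : ℤ, (a : ℝ) * π < b * π → a < b := fun a b hab => by
    exact_mod_cast lt_of_mul_lt_mul_right hab hπ.le
  have b1 : k₂ - k₁ < 1 := hlt _ _ (by push_cast; linarith)
  have b2 : -1 < k₂ - k₁ := hlt _ _ (by push_cast; linarith)
  have b3 : k₂ - k₀ < 0 := hlt _ _ (by push_cast; linarith)
  have b4 : -1 < k₁ - k₀ := hlt _ _ (by push_cast; linarith)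
  omega

/-! ### A positive annihilator by separation -/

/-- **Stiemke's lemma**: a subspace of `ℝᶥ` which meets the non-negative orthant only in the
origin is annihilated by a strictly positive vector. -/
theorem Submodule.exists_pos_sum_mul_eq_zero {ι : Type*} [Fintype ι] (B : Submodule ℝ (ι → ℝ))
    (hB : ∀ z ∈ B, 0 ≤ z → z = 0) : ∃ c : ι → ℝ, (∀ i, 0 < c i) ∧ ∀ z ∈ B, ∑ i, c i * z i = 0 := by
  classical
  have hdisj : Disjoint (stdSimplex ℝ ι) (B : Set (ι → ℝ)) := by
    rw [Set.disjoint_left]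
    intro z hz hzB
    have h0 := hB z hzB hz.1
    simpa [h0] using hz.2
  obtain ⟨f, u, v, hfu, huv, hfv⟩ := geometric_hahn_banach_compact_closed
    (convex_stdSimplex ℝ ι) (isCompact_stdSimplex ℝ ι) B.convex B.closed_of_finiteDimensional hdisj
  have hv : v < 0 := by simpa using hfv 0 B.zero_mem
  have hfB : ∀ z ∈ B, f z = 0 := fun z hz => by
    by_contra hne
    have h := hfv ((v / f z) • z) (B.smul_mem _ hz)
    rw [map_smul, smul_eq_mul, div_mul_cancel₀ _ hne] at h
    exact lt_irrefl _ h
  -- The separating functional is below `v < 0` on the simplex, hence negative at its vertices.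
  refine ⟨fun i => -f (Pi.single i 1), fun i => ?_, fun z hz => ?_⟩
  · have := hfu _ (single_mem_stdSimplex ℝ i)
    linarith
  · have h : f z = ∑ i, z i * f (Pi.single i 1) := by
      conv_lhs => rw [pi_eq_sum_univ' z]
      simp [map_sum]
    rw [hfB z hz] at h
    simp only [neg_mul, Finset.sum_neg_distrib, neg_eq_zero]
    rw [h]
    exact Finset.sum_congr rfl fun i _ => mul_comm _ _

/-! ### The obstruction problems -/

namespace ReachControl

variable {n m : ℕ} {S : Affine.Simplex ℝ (EuclideanSpace ℝ (Fin n)) n}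
  {h : Fin (n + 1) → EuclideanSpace ℝ (Fin n)} {sys : ControlSystem n m}

theorem not_mem_supportIndices {x : EuclideanSpace ℝ (Fin n)} {j : Fin (n + 1)}
    (hx : x ∈ convexHull ℝ (S.points '' {j}ᶜ)) : j ∉ supportIndices S x :=
  fun hj => Set.mem_sInter.mp hj _ hx rfl

/-- Both endpoints `v_0` and `v_i` are vertices of the facet opposite `v_j`. -/
theorem mem_convexHull_compl_of_lineMap {x : EuclideanSpace ℝ (Fin n)} {i j : Fin n} (hij : i ≠ j)
    (hx : x ∈ AffineMap.lineMap (S.points 0) (S.points i.succ) '' Set.Ioc (0 : ℝ) 1) :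
    x ∈ convexHull ℝ (S.points '' {j.succ}ᶜ) := by
  obtain ⟨t, ht, rfl⟩ := hx
  refine (convex_convexHull ℝ _).lineMap_mem
    (subset_convexHull ℝ _ (Set.mem_image_of_mem S.points ?_))
    (subset_convexHull ℝ _ (Set.mem_image_of_mem S.points ?_)) ⟨ht.1.le, ht.2⟩
  · simpa using (Fin.succ_ne_zero j).symm
  · simpa using hij

/-- If `P` avoids the support condition `j ∈ I(x)` somewhere for every `j ≠ 0`, then `cone(P)` is
the polyhedral cone cut out by all the normals `h_j`, `j ≠ 0`. -/
theorem mem_coneOf_iff {P : Set (EuclideanSpace ℝ (Fin n))}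
    (hP : ∀ j : Fin n, ∃ x ∈ P, j.succ ∉ supportIndices S x) {y : EuclideanSpace ℝ (Fin n)} :
    y ∈ coneOf S h P ↔ ∀ j : Fin n, inner ℝ (h j.succ) y ≤ 0 := by
  refine ⟨fun hy j => ?_, fun hy => ?_⟩
  · obtain ⟨x, hx, hj⟩ := hP j
    exact Set.mem_iInter₂.mp hy x hx _ (Fin.succ_ne_zero j) hj
  · refine Set.mem_iInter₂.mpr fun x _ j hj _ => ?_
    obtain ⟨i, rfl⟩ := Fin.exists_succ_eq_of_ne_zero hj
    exact hy i

theorem AffineSolvable.continuousSolvable (hf : AffineSolvable S h sys) :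
    ContinuousSolvable S h sys := by
  obtain ⟨f, ⟨g, hg⟩, hC, h0⟩ := hf
  refine ⟨f, Continuous.subtype_mk (f := fun x => (f x : EuclideanSpace ℝ (Fin n))) ?_ _, hC, h0⟩
  simp only [hg]
  exact g.continuous_of_finiteDimensional.comp continuous_subtype_val

/-- A non-zero vector in `𝓑 ∩ cone(𝒪_𝒮)` gives a constant solution. -/
theorem affineSolvable_of_coneOf_inter_ne
    (hne : coneOf S h (equilibriaIn S sys) ∩
      (sys.inputSpace : Set (EuclideanSpace ℝ (Fin n))) ≠ {0}) : AffineSolvable S h sys := by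
  obtain ⟨y, ⟨hyC, hyB⟩, hy0⟩ : ∃ y ∈ coneOf S h (equilibriaIn S sys) ∩
      (sys.inputSpace : Set (EuclideanSpace ℝ (Fin n))), y ≠ 0 := by
    by_contra! hall
    refine hne (Set.Subset.antisymm hall ?_)
    rintro _ rfl
    exact ⟨Set.mem_iInter₂.mpr fun x _ j _ _ => by simp, sys.inputSpace.zero_mem⟩
  exact ⟨fun _ => ⟨y, hyB⟩, ⟨AffineMap.const ℝ _ y, fun _ => rfl⟩,
    fun x => Set.mem_iInter₂.mp hyC x x.2, fun _ hx => hy0 (congrArg Subtype.val hx)⟩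

theorem coneOf_inter_ne_of_continuousSolvable {sys : ControlSystem 3 m}
    {S : Affine.Simplex ℝ (EuclideanSpace ℝ (Fin 3)) 3} {h : Fin 4 → EuclideanSpace ℝ (Fin 3)}
    {o : Fin 3 → EuclideanSpace ℝ (Fin 3)}
    (hOS : equilibriaIn S sys = convexHull ℝ (Set.range o))
    (ho : ∀ i : Fin 3,
      o i ∈ AffineMap.lineMap (S.points 0) (S.points i.succ) '' Set.Ioc (0 : ℝ) 1)
    (hf : ContinuousSolvable S h sys) :
    coneOf S h (equilibriaIn S sys) ∩
      (sys.inputSpace : Set (EuclideanSpace ℝ (Fin 3))) ≠ {0} := by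
  intro hcone
  obtain ⟨f, hfc, hfC, hf0⟩ := hf
  have hmem : ∀ i, o i ∈ equilibriaIn S sys := fun i =>
    hOS ▸ subset_convexHull ℝ _ (Set.mem_range_self i)
  have hP : ∀ j : Fin 3, ∃ x ∈ equilibriaIn S sys, j.succ ∉ supportIndices S x := fun j => by
    obtain ⟨i, hij⟩ := exists_ne j
    exact ⟨o i, hmem i, not_mem_supportIndices (mem_convexHull_compl_of_lineMap hij (ho i))⟩
  have hzero : ∀ y ∈ sys.inputSpace, (∀ j : Fin 3, inner ℝ (h j.succ) y ≤ 0) → y = 0 :=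
    fun y hyB hy => hcone.subset ⟨(mem_coneOf_iff hP).mpr hy, hyB⟩
  let L : EuclideanSpace ℝ (Fin 3) →ₗ[ℝ] Fin 3 → ℝ :=
    LinearMap.pi fun j => -(innerₗ (EuclideanSpace ℝ (Fin 3)) (h j.succ))
  have hL : ∀ y j, L y j = -inner ℝ (h j.succ) y := fun y j => rfl
  obtain ⟨c, hc, hcB⟩ := (sys.inputSpace.map L).exists_pos_sum_mul_eq_zero (by
    rintro _ ⟨y, hyB, rfl⟩ hy
    have : y = 0 := hzero y hyB fun j => by
      have := hy j
      rw [hL, Pi.zero_apply] at this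
      linarith
    rw [this, map_zero])
  let q : (Fin 3 → ℝ) → EuclideanSpace ℝ (Fin 3) := fun x => ∑ i, x i • o i
  have hq : ∀ x ∈ stdSimplex ℝ (Fin 3), q x ∈ equilibriaIn S sys := fun x hx => by
    rw [hOS]
    exact (convex_convexHull ℝ _).sum_mem (fun i _ => hx.1 i) hx.2
      fun i _ => subset_convexHull ℝ _ (Set.mem_range_self i)
  have hqs : ∀ x ∈ stdSimplex ℝ (Fin 3), ∀ i, x i = 0 → i.succ ∉ supportIndices S (q x) :=
    fun x hx j hj => by
    refine not_mem_supportIndices ?_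
    have hsum : ∑ i ∈ Finset.univ.erase j, x i • o i = q x :=
      Finset.sum_erase _ (by simp [hj])
    rw [← hsum]
    refine (convex_convexHull ℝ _).sum_mem (fun i _ => hx.1 i) ?_
      fun i hi => mem_convexHull_compl_of_lineMap (Finset.ne_of_mem_erase hi) (ho i)
    rw [Finset.sum_erase _ hj]
    exact hx.2
  classical
  -- The default `0` is never taken on the triangle, by `hq`.
  let F : (Fin 3 → ℝ) → EuclideanSpace ℝ (Fin 3) := fun x =>
    if hx : q x ∈ equilibriaIn S sys then f ⟨q x, hx⟩ else 0
  have hF : ∀ x (hx : x ∈ stdSimplex ℝ (Fin 3)), F x = f ⟨q x, hq x hx⟩ := fun x hx =>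
    dif_pos (hq x hx)
  have hFc : ContinuousOn F (stdSimplex ℝ (Fin 3)) := by
    rw [continuousOn_iff_continuous_domRestrict]
    have : (stdSimplex ℝ (Fin 3)).domRestrict F = fun x : stdSimplex ℝ (Fin 3) =>
        (f ⟨q x.1, hq x.1 x.2⟩ : EuclideanSpace ℝ (Fin 3)) :=
      funext fun x => hF x.1 x.2
    rw [this]
    exact continuous_subtype_val.comp (hfc.comp (Continuous.subtype_mk (by fun_prop) _))
  obtain ⟨x, hx, hwx⟩ := exists_eq_zero_of_nonneg_on_edges (w := fun x j => c j * L (F x) j)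
    (by
      refine continuousOn_pi.mpr fun j => continuousOn_const.mul ?_
      simp only [hL]
      exact (continuousOn_const.inner hFc).neg)
    (fun x hx => hcB _ ⟨F x, by rw [hF x hx]; exact (f _).2, rfl⟩)
    (fun x hx j hj => mul_nonneg (hc j).le (by
      rw [hL, hF x hx]
      exact neg_nonneg.mpr (hfC _ _ (Fin.succ_ne_zero j) (hqs x hx j hj))))
  refine hf0 ⟨q x, hq x hx⟩ (Subtype.ext ?_)
  refine hzero _ (f _).2 fun j => ?_
  have hj := (mul_eq_zero.mp (congrFun hwx j)).resolve_left (hc j).ne'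
  rw [hL, hF x hx, neg_eq_zero] at hj
  exact hj.le

end ReachControl

theorem mainTheorem1 {m : ℕ} (sys : ReachControl.ControlSystem 3 m)
    (S : Affine.Simplex ℝ (EuclideanSpace ℝ (Fin 3)) 3)
    (h : Fin 4 → EuclideanSpace ℝ (Fin 3))
    (hh : ∀ j, ReachControl.IsOutwardNormal S j (h j))
    (o : Fin 3 → EuclideanSpace ℝ (Fin 3))
    (hOS : ReachControl.equilibriaIn S sys = convexHull ℝ (Set.range o))
    (hv0 : S.points 0 ∉ ReachControl.equilibriaIn S sys)
    (ho : ∀ i : Fin 3,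
      o i ∈ AffineMap.lineMap (S.points 0) (S.points i.succ) '' Set.Ioc (0 : ℝ) 1) :
    (ReachControl.ContinuousSolvable S h sys ↔
      ReachControl.coneOf S h (ReachControl.equilibriaIn S sys) ∩
        (sys.inputSpace : Set (EuclideanSpace ℝ (Fin 3))) ≠ {0}) ∧
    (ReachControl.AffineSolvable S h sys ↔
      ReachControl.coneOf S h (ReachControl.equilibriaIn S sys) ∩
        (sys.inputSpace : Set (EuclideanSpace ℝ (Fin 3))) ≠ {0}) := by
  have hfwd := ReachControl.coneOf_inter_ne_of_continuousSolvable (h := h) hOS ho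
  have hbwd := ReachControl.affineSolvable_of_coneOf_inter_ne (S := S) (h := h) (sys := sys)
  exact ⟨⟨hfwd, fun hne => (hbwd hne).continuousSolvable⟩,
    ⟨fun hf => hfwd hf.continuousSolvable, hbwd⟩⟩
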